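/- Let $n\ge 2$, $[n]=\{1,\dots,n\}$, and let $\{m_I\}$ and $\{M_I\}$ be two families of real numbers indexed by the $2$-subsets $I$ of $[n]$, with $m_I\le M_I$ for every $I$. A weighted tree $\mathcal T=(T,w)$ is a finite tree $T$ with an arbitrary function $w:E(T)\to\mathbb R$; $L(T)$ is its set of leaves (vertices of degree one), and $D_{\{i,j\}}(\mathcal T)$ is the minimum of the weights (sums of the edge weights) of the simple paths joining $i$ and $j$ (in a tree, the weight of the unique such path). A split of a $4$-subset (quartet) $\{a,b,c,d\}$ of $[n]$ is a partition of it into two $2$-subsets; $(a,b\,|\,c,d)$ denotes $\{\{a,b\},\{c,d\}\}$. A set $S$ of splits of quartets of $[n]$ is called - fat if, for every quartet of $[n]$, either exactly one of its three splits or all of them are in $S$; - transitive if, for all distinct $a,b,c,d,e$, $(a,b\,|\,c,d)\in S$ and $(a,b\,|\,c,e)\in S$ imply $(a,b\,|\,d,e)\in S$; - saturated if, for all distinct $a_1,a_2,b_1,b_2,x$, $(a_1,a_2\,|\,b_1,b_2)\in S$ implies $(a_1,x\,|\,b_1,b_2)\in S$ or $(a_1,a_2\,|\,b_1,x)\in S$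 (possibly both). Then there exists a weighted tree $\mathcal T=(T,w)$ with $L(T)=[n]$ and $D_I(\mathcal T)\in[m_I,M_I]$ for every $2$-subset $I$ of $[n]$ if and only if there exists a set $S$ of splits of quartets of $[n]$ such that (i) $S$ is fat, transitive and saturated; (ii) $m_{\sigma_1}+\dots+m_{\sigma_r}\le M_{\tau_1}+\dots+M_{\tau_r}$ for all $r$ and all families $(\sigma_1,\dots,\sigma_r)$ and $(\tau_1,\dots,\tau_r)$ of $2$-subsets of $[n]$ that partition the same multiset of elements of $[n]$ (elements and $2$-subsets may be repeated) and are such that $(\sigma_1,\dots,\sigma_r)$ can be obtained, up to order, from $(\tau_1,\dots,\tau_r)$ by finitely many transformations, each replacing two members $\{i,k\},\{j,l\}$ of the family by $\{i,j\},\{k,l\}$ for some $(j,k\,|\,i,l)\in S$. -/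

import Mathlib

/-! ### Weighted graphs and their 2-weights -/

/-- The weight of a walk, i.e. the sum of the weights of its edges. The weight function `w` lives on
`Sym2 V`; only its values on edges are ever used. -/
def walkWeight {V : Type*} {G : SimpleGraph V} (w : Sym2 V → ℝ) {u v : V} (p : G.Walk u v) : ℝ :=
  (p.edges.map w).sum

/-- The 2-weight `D_{u,v}` of the weighted graph `(G, w)`: the minimum of the weights of the simple
paths of `G` joining `u` and `v`. (See `isLeast_twoWeight`: for a finite connected graph the
infimum is a minimum.) -/
noncomputable def twoWeight {V : Type*} (G : SimpleGraph V) (w : Sym2 V → ℝ) (u v : V) : ℝ :=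
  sInf (Set.range fun p : G.Path u v => walkWeight w p.1)

theorem isLeast_twoWeight {V : Type*} [Finite V] (G : SimpleGraph V) (hG : G.Connected)
    (w : Sym2 V → ℝ) (u v : V) :
    IsLeast (Set.range fun p : G.Path u v => walkWeight w p.1) (twoWeight G w u v) := by
  classical
  have := Fintype.ofFinite V
  have hfin : (Set.range fun p : G.Path u v => walkWeight w p.1).Finite := Set.finite_range _
  obtain ⟨p⟩ := hG.preconnected u v
  have hne : (Set.range fun p : G.Path u v => walkWeight w p.1).Nonempty := ⟨_, p.toPath, rfl⟩
  exact ⟨hne.csInf_mem hfin, fun x hx => csInf_le hfin.bddBelow hx⟩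

/-- `v` is a leaf of `G`: a vertex of degree one. -/
def IsLeaf {V : Type*} (G : SimpleGraph V) (v : V) : Prop := (G.neighborSet v).ncard = 1

/-- A finite tree with real edge weights whose set of leaves is identified with `Fin n`
by the labelling `leaf`. No sign condition is imposed on the weights. -/
structure WeightedTree (n : ℕ) where
  V : Type
  finite : Finite V
  graph : SimpleGraph V
  isTree : graph.IsTree
  weight : Sym2 V → ℝ
  leaf : Fin n → V
  leaf_injective : Function.Injective leaf
  range_leaf : Set.range leaf = {v | IsLeaf graph v}

/-- The 2-weight of the leaves labelled `i` and `j`. -/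
noncomputable def WeightedTree.D {n : ℕ} (T : WeightedTree n) (i j : Fin n) : ℝ :=
  twoWeight T.graph T.weight (T.leaf i) (T.leaf j)

/-! ### Systems of quartet splits -/

/-- The split `(a, b | c, d)`, i.e. `{{a, b}, {c, d}}`. -/
def split {X : Type*} (a b c d : X) : Sym2 (Sym2 X) := s(s(a, b), s(c, d))

/-- `S` is a system of splits of quartets (4-subsets) of `X`. -/
def IsSplitSystem {X : Type*} (S : Set (Sym2 (Sym2 X))) : Prop :=
  ∀ s ∈ S, ∃ a b c d : X, [a, b, c, d].Nodup ∧ s = split a b c d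

/-- For every quartet, either all three of its splits or exactly one of them is in `S`. -/
def IsFat {X : Type*} (S : Set (Sym2 (Sym2 X))) : Prop :=
  ∀ a b c d : X, [a, b, c, d].Nodup →
    (split a b c d ∈ S ∧ split a c b d ∈ S ∧ split a d b c ∈ S) ∨
    (split a b c d ∈ S ∧ split a c b d ∉ S ∧ split a d b c ∉ S) ∨
    (split a b c d ∉ S ∧ split a c b d ∈ S ∧ split a d b c ∉ S) ∨
    (split a b c d ∉ S ∧ split a c b d ∉ S ∧ split a d b c ∈ S)

def IsTransitiveSystem {X : Type*} (S : Set (Sym2 (Sym2 X))) : Prop :=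
  ∀ a b c d e : X, [a, b, c, d, e].Nodup →
    split a b c d ∈ S → split a b c e ∈ S → split a b d e ∈ S

def IsSaturated {X : Type*} (S : Set (Sym2 (Sym2 X))) : Prop :=
  ∀ a₁ a₂ b₁ b₂ x : X, [a₁, a₂, b₁, b₂, x].Nodup →
    split a₁ a₂ b₁ b₂ ∈ S → split a₁ x b₁ b₂ ∈ S ∨ split a₁ a₂ b₁ x ∈ S

/-! ### Families of 2-sets and exchanges -/

/-- The family `σ = (σ₁, …, σᵣ)` (its order is irrelevant) consists of 2-subsets of `X` and is a
partition of the multiset `A`: each element of `X` lies in as many of the `σᵢ`, counted with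
repetition, as its multiplicity in `A`. -/
def IsPairPartition {X : Type*} (A : Multiset X) (σ : Multiset (Sym2 X)) : Prop :=
  (∀ e ∈ σ, ¬ e.IsDiag) ∧ σ.bind Sym2.toMultiset = A

/-- `σ` is obtained from `τ` by one transformation `(i,k), (j,l) ↦ (i,j), (k,l)` with
`(j, k | i, l) ∈ S`. -/
def Exchange {X : Type*} (S : Set (Sym2 (Sym2 X))) (τ σ : Multiset (Sym2 X)) : Prop :=
  ∃ (i j k l : X) (ρ : Multiset (Sym2 X)), split j k i l ∈ S ∧
    τ = s(i, k) ::ₘ s(j, l) ::ₘ ρ ∧ σ = s(i, j) ::ₘ s(k, l) ::ₘ ρ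

/-! From a tree to $S$: every edge cuts the leaves into two sides, and the cuts of a tree are
pairwise compatible. Let $S$ consist of the splits $(a,b\,|\,c,d)$ such that every cut leaves $a,b$
together or $c,d$ together. Compatibility makes $S$ fat and saturated (`isFat_cutSplits`,
`isSaturated_cutSplits`). As $D$ is the sum of the weights of the separating edges
(`twoWeight_eq_sum_cuts`), it satisfies $D_{ik}+D_{jl}=D_{ij}+D_{kl}$ for every $(j,k\,|\,i,l)\in
S$. So exchanges preserve the total of $D$, and $m\le D\le M$ gives the inequalities.

From $S$ to a tree there are two independent problems. The first is linear programming: find a point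
$D$ of the box that satisfies the four-point equations of $S$. By duality (`exists_box_solution`) an
obstruction is a linear combination of the equations, and its coefficients can be taken integral. An
integral combination is the difference of the counting vectors of two families related by exchanges
(`exists_exchanges_of_mem_closure`), so condition (ii), after cancellation of common members, rules
it out.

The second is to realize $D$ by a tree (`isTreeRealizable_of_fourPoint`), by induction on the number
of leaves. The system $S$ has a cherry $a,b$: all splits $(a,b\,|\,c,d)$ belong to it
(`exists_cherry`). The equations then say that $D_{ac}-D_{bc}$ does not depend on $c$, so $a$ and
$b$ can be hung on a common vertex of a tree for the remaining labels. Weights of any sign are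
allowed, so no inequality has to be checked. -/

/-! ### Exchanges and integral combinations of four-point relations -/

section Exchange

variable {X : Type*}

theorem split_comm_left (a b c d : X) : split a b c d = split b a c d := by
  simp only [split, Sym2.eq_swap (a := a) (b := b)]

theorem split_comm_right (a b c d : X) : split a b c d = split a b d c := by
  simp only [split, Sym2.eq_swap (a := c) (b := d)]

theorem split_swap (a b c d : X) : split a b c d = split c d a b := Sym2.eq_swap

theorem split_eq_split_iff {a b c d a' b' c' d' : X} :
    split a b c d = split a' b' c' d' ↔
      (((a = a' ∧ b = b') ∨ (a = b' ∧ b = a')) ∧ ((c = c' ∧ d = d') ∨ (c = d' ∧ d = c'))) ∨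
      (((a = c' ∧ b = d') ∨ (a = d' ∧ b = c')) ∧ ((c = a' ∧ d = b') ∨ (c = b' ∧ d = a'))) := by
  simp only [split, Sym2.eq_iff]

theorem IsSplitSystem.nodup {S : Set (Sym2 (Sym2 X))} (hS : IsSplitSystem S) {a b c d : X}
    (h : split a b c d ∈ S) : [a, b, c, d].Nodup := by
  obtain ⟨a', b', c', d', hn, he⟩ := hS _ h
  rw [split_eq_split_iff] at he
  simp only [List.nodup_cons, List.mem_cons, List.not_mem_nil, or_false, not_or,
    not_false_eq_true, List.nodup_nil, and_true] at hn ⊢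
  grind

/-- Interchanging $j$ and $k$ reverses the move and leaves the split $(j,k\,|\,i,l)$ unchanged. -/
theorem Exchange.symm {S : Set (Sym2 (Sym2 X))} {τ σ : Multiset (Sym2 X)}
    (h : Exchange S τ σ) : Exchange S σ τ := by
  obtain ⟨i, j, k, l, ρ, hs, rfl, rfl⟩ := h
  exact ⟨i, k, j, l, ρ, by rwa [split_comm_left], rfl, rfl⟩

theorem Exchange.add_right {S : Set (Sym2 (Sym2 X))} {τ σ : Multiset (Sym2 X)}
    (h : Exchange S τ σ) (ρ : Multiset (Sym2 X)) : Exchange S (τ + ρ) (σ + ρ) := by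
  obtain ⟨i, j, k, l, ρ', hs, rfl, rfl⟩ := h
  exact ⟨i, j, k, l, ρ' + ρ, hs, by simp, by simp⟩

theorem Exchange.bind_toMultiset {S : Set (Sym2 (Sym2 X))} {τ σ : Multiset (Sym2 X)}
    (h : Exchange S τ σ) : σ.bind Sym2.toMultiset = τ.bind Sym2.toMultiset := by
  obtain ⟨i, j, k, l, ρ, hs, rfl, rfl⟩ := h
  simp only [Multiset.cons_bind, ← add_assoc]
  congr 1
  change ({i, j} : Multiset X) + {k, l} = {i, k} + {j, l}
  simp only [Multiset.insert_eq_cons, ← Multiset.singleton_add]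
  abel

theorem Exchange.not_isDiag {S : Set (Sym2 (Sym2 X))} (hS : IsSplitSystem S)
    {τ σ : Multiset (Sym2 X)} (h : Exchange S τ σ) (hτ : ∀ e ∈ τ, ¬ e.IsDiag) :
    ∀ e ∈ σ, ¬ e.IsDiag := by
  obtain ⟨i, j, k, l, ρ, hs, rfl, rfl⟩ := h
  have := hS.nodup hs
  simp only [List.nodup_cons, List.mem_cons, List.not_mem_nil, or_false, not_or,
    not_false_eq_true, List.nodup_nil, and_true] at this
  intro e he
  simp only [Multiset.mem_cons] at he hτ
  rcases he with rfl | rfl | he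
  · simp only [Sym2.mk_isDiag_iff]; grind
  · simp only [Sym2.mk_isDiag_iff]; grind
  · exact hτ e (Or.inr (Or.inr he))

theorem exchanges_symm {S : Set (Sym2 (Sym2 X))} {τ σ : Multiset (Sym2 X)}
    (h : Relation.ReflTransGen (Exchange S) τ σ) : Relation.ReflTransGen (Exchange S) σ τ := by
  induction h with
  | refl => exact .refl
  | tail _ h ih => exact .head h.symm ih

theorem exchanges_add_right {S : Set (Sym2 (Sym2 X))} {τ σ : Multiset (Sym2 X)}
    (h : Relation.ReflTransGen (Exchange S) τ σ) (ρ : Multiset (Sym2 X)) :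
    Relation.ReflTransGen (Exchange S) (τ + ρ) (σ + ρ) := by
  induction h with
  | refl => exact .refl
  | tail _ h ih => exact ih.tail (h.add_right ρ)

theorem exchanges_add {S : Set (Sym2 (Sym2 X))} {τ σ τ' σ' : Multiset (Sym2 X)}
    (h : Relation.ReflTransGen (Exchange S) τ σ) (h' : Relation.ReflTransGen (Exchange S) τ' σ') :
    Relation.ReflTransGen (Exchange S) (τ + τ') (σ + σ') := by
  refine (exchanges_add_right h τ').trans ?_
  rw [add_comm σ, add_comm σ]
  exact exchanges_add_right h' σ

theorem exchanges_bind_toMultiset {S : Set (Sym2 (Sym2 X))} {τ σ : Multiset (Sym2 X)}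
    (h : Relation.ReflTransGen (Exchange S) τ σ) :
    σ.bind Sym2.toMultiset = τ.bind Sym2.toMultiset := by
  induction h with
  | refl => rfl
  | tail _ h ih => rw [h.bind_toMultiset, ih]

theorem exchanges_not_isDiag {S : Set (Sym2 (Sym2 X))} (hS : IsSplitSystem S)
    {τ σ : Multiset (Sym2 X)} (h : Relation.ReflTransGen (Exchange S) τ σ)
    (hτ : ∀ e ∈ τ, ¬ e.IsDiag) : ∀ e ∈ σ, ¬ e.IsDiag := by
  induction h with
  | refl => exact hτ
  | tail _ h ih => exact h.not_isDiag hS ih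

/-- A common part of two families can be used as a catalyst for iterating the exchanges. -/
theorem exchanges_nsmul_add {S : Set (Sym2 (Sym2 X))} {τ σ ρ : Multiset (Sym2 X)}
    (h : Relation.ReflTransGen (Exchange S) (τ + ρ) (σ + ρ)) (N : ℕ) :
    Relation.ReflTransGen (Exchange S) (N • τ + ρ) (N • σ + ρ) := by
  induction N with
  | zero => simpa using .refl
  | succ N ih =>
    have h₁ := exchanges_add_right h (N • τ)
    have h₂ := exchanges_add_right ih σ
    have e₁ : (N + 1) • τ + ρ = τ + ρ + N • τ := by rw [succ_nsmul]; abel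
    have e₂ : σ + ρ + N • τ = N • τ + ρ + σ := by abel
    have e₃ : (N + 1) • σ + ρ = N • σ + ρ + σ := by rw [succ_nsmul]; abel
    rw [e₁, e₃]
    rw [e₂] at h₁
    exact h₁.trans h₂

/-- The inequality between the families of an exchange sequence persists when common members are
cancelled. -/
theorem sum_map_sub_le_of_exchanges [DecidableEq X] {S : Set (Sym2 (Sym2 X))}
    (hS : IsSplitSystem S) {m M : Sym2 X → ℝ}
    (H : ∀ (A : Multiset X) (σ τ : Multiset (Sym2 X)),
        IsPairPartition A σ → IsPairPartition A τ → Relation.ReflTransGen (Exchange S) τ σ →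
        (σ.map m).sum ≤ (τ.map M).sum) {τ σ : Multiset (Sym2 X)}
    (h : Relation.ReflTransGen (Exchange S) τ σ) (hτ : ∀ e ∈ τ, ¬ e.IsDiag) :
    ((σ - τ).map m).sum ≤ ((τ - σ).map M).sum := by
  have hτ' : (τ - σ) + τ ∩ σ = τ := Multiset.sub_add_inter τ σ
  have hσ' : (σ - τ) + τ ∩ σ = σ := by rw [Multiset.inter_comm]; exact Multiset.sub_add_inter σ τ
  have h' : Relation.ReflTransGen (Exchange S) ((τ - σ) + τ ∩ σ) ((σ - τ) + τ ∩ σ) := by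
    rwa [hτ', hσ']
  by_contra! hlt
  set x := ((σ - τ).map m).sum
  set y := ((τ - σ).map M).sum
  set z := ((τ ∩ σ).map m).sum
  set t := ((τ ∩ σ).map M).sum
  -- If $x>y$, then $Nx+z\le Ny+t$ fails once $N(x-y)>t-z$.
  obtain ⟨N, hN⟩ := exists_nat_gt ((t - z) / (x - y))
  rw [div_lt_iff₀ (by linarith)] at hN
  have hN' := exchanges_nsmul_add h' N
  have hd : ∀ e ∈ N • (τ - σ) + τ ∩ σ, ¬ e.IsDiag := by
    intro e he
    rcases Multiset.mem_add.1 he with he | he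
    · exact hτ e (Multiset.mem_of_le (Multiset.sub_le_self _ _) (Multiset.mem_of_mem_nsmul he))
    · exact hτ e (Multiset.mem_of_le Multiset.inter_le_left he)
  have key := H _ _ _ ⟨exchanges_not_isDiag hS hN' hd, exchanges_bind_toMultiset hN'⟩
    ⟨hd, rfl⟩ hN'
  simp only [Multiset.map_add, Multiset.sum_add, Multiset.map_nsmul, Multiset.sum_nsmul,
    nsmul_eq_mul] at key
  change N * x + z ≤ N * y + t at key
  nlinarith

/-- The linear form `D ↦ D {i,k} + D {j,l} - D {i,j} - D {k,l}`, as an integral vector. -/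
def fourPointVector [DecidableEq X] (i j k l : X) : Sym2 X → ℤ :=
  Pi.single s(i, k) 1 + Pi.single s(j, l) 1 - Pi.single s(i, j) 1 - Pi.single s(k, l) 1

/-- The vectors of the relations given by the splits in `S`. -/
def fourPointVectors [DecidableEq X] (S : Set (Sym2 (Sym2 X))) : Set (Sym2 X → ℤ) :=
  {v | ∃ i j k l, split j k i l ∈ S ∧ v = fourPointVector i j k l}

/-- A generator is a single exchange, a sum is a juxtaposition of families, and a negative reverses
the exchanges. The two families may share members, so they need not be the positive and negative
parts of $v$. -/
theorem exists_exchanges_of_mem_closure [DecidableEq X] {S : Set (Sym2 (Sym2 X))}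
    (hS : IsSplitSystem S) {v : Sym2 X → ℤ}
    (hv : v ∈ AddSubgroup.closure (fourPointVectors S)) :
    ∃ τ σ : Multiset (Sym2 X), (∀ e ∈ τ, ¬ e.IsDiag) ∧ Relation.ReflTransGen (Exchange S) τ σ ∧
      ∀ e, v e = (τ.count e : ℤ) - σ.count e := by
  induction hv using AddSubgroup.closure_induction with
  | mem v hv =>
    obtain ⟨i, j, k, l, hs, rfl⟩ := hv
    refine ⟨{s(i, k), s(j, l)}, {s(i, j), s(k, l)}, ?_, .single ⟨i, j, k, l, 0, hs, rfl, rfl⟩, ?_⟩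
    · have := hS.nodup hs
      simp only [List.nodup_cons, List.mem_cons, List.not_mem_nil, or_false, not_or,
        not_false_eq_true, List.nodup_nil, and_true] at this
      intro e he
      simp only [Multiset.insert_eq_cons, Multiset.mem_cons, Multiset.mem_singleton] at he
      rcases he with rfl | rfl <;> simp only [Sym2.mk_isDiag_iff] <;> grind
    · intro e
      simp only [fourPointVector, Pi.add_apply, Pi.sub_apply, Pi.single_apply,
        Multiset.insert_eq_cons, Multiset.count_cons, Multiset.count_singleton]
      push_cast
      ring
  | zero => exact ⟨0, 0, by simp, .refl, by simp⟩
  | add v w _ _ hv hw =>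
    obtain ⟨τ, σ, hd, h, hc⟩ := hv
    obtain ⟨τ', σ', hd', h', hc'⟩ := hw
    refine ⟨τ + τ', σ + σ', ?_, exchanges_add h h', ?_⟩
    · intro e he
      exact (Multiset.mem_add.1 he).elim (hd e) (hd' e)
    · intro e
      simp only [Pi.add_apply, hc, hc', Multiset.count_add]
      push_cast
      ring
  | neg v _ hv =>
    obtain ⟨τ, σ, hd, h, hc⟩ := hv
    refine ⟨σ, τ, exchanges_not_isDiag hS h hd, exchanges_symm h, ?_⟩
    intro e
    simp [hc]

end Exchange

/-! ### Solutions of integral homogeneous linear equations in a box -/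

section Box

variable {ι E : Type*} [Fintype ι] [Fintype E]

/-- The maximum over the box `∏ [m e, M e]` of the linear form with coefficients
`∑ t, c t * r t e`. -/
noncomputable def boxSup (r : ι → E → ℤ) (m M : E → ℝ) (c : ι → ℝ) : ℝ :=
  ∑ e, max ((∑ t, c t * r t e) * M e) ((∑ t, c t * r t e) * m e)

theorem continuous_boxSup (r : ι → E → ℤ) (m M : E → ℝ) : Continuous (boxSup r m M) := by
  unfold boxSup
  fun_prop

theorem boxSup_smul (r : ι → E → ℤ) (m M : E → ℝ) (c : ι → ℝ) {N : ℝ} (hN : 0 ≤ N) :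
    boxSup r m M (fun t => N * c t) = N * boxSup r m M c := by
  unfold boxSup
  rw [Finset.mul_sum]
  refine Finset.sum_congr rfl fun e _ => ?_
  rw [mul_max_of_nonneg _ _ hN]
  simp only [mul_assoc, ← Finset.mul_sum]

/-- Positive homogeneity clears denominators, which gives rational coefficients; continuity and
density give real ones. -/
theorem boxSup_nonneg_of_int {r : ι → E → ℤ} {m M : E → ℝ}
    (h : ∀ c : ι → ℤ, 0 ≤ boxSup r m M fun t => c t) (c : ι → ℝ) : 0 ≤ boxSup r m M c := by
  have hd : DenseRange (Pi.map fun (_ : ι) (q : ℚ) => (q : ℝ)) :=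
    DenseRange.piMap fun _ => Rat.isDenseEmbedding_coe_real.dense
  refine hd.induction_on c (isClosed_Ici.preimage (continuous_boxSup r m M)) fun q => ?_
  change 0 ≤ boxSup r m M _
  have hN : (0 : ℝ) < ((∏ t, (q t).den : ℕ) : ℝ) := by
    exact_mod_cast Finset.prod_pos fun t _ => (q t).pos
  have hz : ∀ t, ∃ z : ℤ, (z : ℝ) = ((∏ t, (q t).den : ℕ) : ℝ) * (q t : ℝ) := by
    intro t
    obtain ⟨d, hd⟩ := Finset.dvd_prod_of_mem (fun t => (q t).den) (Finset.mem_univ t)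
    refine ⟨d * (q t).num, ?_⟩
    rw [hd]
    have h1 : ((q t).den : ℝ) * (q t : ℝ) = (q t).num := by exact_mod_cast Rat.den_mul_eq_num (q t)
    push_cast
    rw [← h1]
    ring
  choose z hz using hz
  have := h z
  simp only [hz] at this
  rw [boxSup_smul _ _ _ _ hN.le] at this
  exact nonneg_of_mul_nonneg_right this hN

theorem exists_box_solution (r : ι → E → ℤ) {m M : E → ℝ} (hmM : ∀ e, m e ≤ M e)
    (h : ∀ c : ι → ℤ, 0 ≤ boxSup r m M fun t => c t) :
    ∃ D : E → ℝ, (∀ e, D e ∈ Set.Icc (m e) (M e)) ∧ ∀ t, ∑ e, r t e * D e = 0 := by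
  classical
  let A : (E → ℝ) →ₗ[ℝ] (ι → ℝ) :=
    LinearMap.pi fun t => ∑ e, (r t e : ℝ) • LinearMap.proj e
  have hA : ∀ D t, A D t = ∑ e, r t e * D e := by
    intro D t
    simp [A]
  by_cases h0 : (0 : ι → ℝ) ∈ A '' Set.Icc m M
  · obtain ⟨D, hD, hD0⟩ := h0
    exact ⟨D, fun e => ⟨hD.1 e, hD.2 e⟩, fun t => by rw [← hA, hD0]; rfl⟩
  · exfalso
    have hc : IsCompact (A '' Set.Icc m M) :=
      isCompact_Icc.image (LinearMap.continuous_of_finiteDimensional A)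
    obtain ⟨f, u, hfu, hu⟩ := geometric_hahn_banach_point_closed
      ((convex_Icc m M).linear_image A) hc.isClosed h0
    rw [map_zero] at hfu
    -- The functional $f$ is positive on the image of the box, so with this sign the form with
    -- coefficients $k$ is negative on the whole box.
    let c : ι → ℝ := fun t => -f (Pi.single t 1)
    let k : E → ℝ := fun e => ∑ t, c t * r t e
    have hf : ∀ D, f (A D) = -∑ e, k e * D e := by
      intro D
      rw [← Finset.univ_sum_single (A D), map_sum]
      have : ∀ t, f (Pi.single t (A D t)) = -(c t * A D t) := by
        intro t
        have : (Pi.single t (A D t) : ι → ℝ) = A D t • Pi.single t 1 := by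
          rw [← Pi.single_smul]; simp
        rw [this, map_smul]
        simp only [c, smul_eq_mul]
        ring
      rw [Finset.sum_congr rfl fun t _ => this t]
      simp only [hA, k, Finset.sum_neg_distrib, Finset.mul_sum, Finset.sum_mul]
      rw [Finset.sum_comm]
      simp only [mul_assoc]
    -- The vertex of the box at which this form is maximal.
    let D : E → ℝ := fun e => if 0 ≤ k e then M e else m e
    have hD : D ∈ Set.Icc m M := by
      constructor <;> intro e <;> by_cases hk : 0 ≤ k e <;> simp [D, hk, hmM]
    have hkD : ∑ e, k e * D e = boxSup r m M c := by
      refine Finset.sum_congr rfl fun e _ => ?_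
      change _ = max (k e * M e) (k e * m e)
      by_cases hk : 0 ≤ k e
      · rw [max_eq_left (mul_le_mul_of_nonneg_left (hmM e) hk)]
        simp [D, hk]
      · rw [max_eq_right (mul_le_mul_of_nonpos_left (hmM e) (not_le.1 hk).le)]
        simp [D, hk]
    have h1 := hu _ ⟨D, hD, rfl⟩
    have h2 := boxSup_nonneg_of_int h c
    rw [hf, hkD] at h1
    linarith

end Box

/-- If the inequalities for exchange sequences hold, some `D` in the box satisfies the four-point
equations of all splits in `S`. -/
theorem exists_fourPoint_solution {X : Type*} [Fintype X] [DecidableEq X] {S : Set (Sym2 (Sym2 X))}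
    (hS : IsSplitSystem S) {m M : Sym2 X → ℝ} (hmM : ∀ i j, i ≠ j → m s(i, j) ≤ M s(i, j))
    (H : ∀ (A : Multiset X) (σ τ : Multiset (Sym2 X)),
        IsPairPartition A σ → IsPairPartition A τ → Relation.ReflTransGen (Exchange S) τ σ →
        (σ.map m).sum ≤ (τ.map M).sum) :
    ∃ D : Sym2 X → ℝ, (∀ i j, i ≠ j → D s(i, j) ∈ Set.Icc (m s(i, j)) (M s(i, j))) ∧
      ∀ i j k l, split j k i l ∈ S → D s(i, k) + D s(j, l) = D s(i, j) + D s(k, l) := by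
  classical
  let ι := {t : X × X × X × X // split t.2.1 t.2.2.1 t.1 t.2.2.2 ∈ S}
  let r : ι → Sym2 X → ℤ := fun t => fourPointVector t.1.1 t.1.2.1 t.1.2.2.1 t.1.2.2.2
  -- off the 2-subsets the box is irrelevant
  let m' : Sym2 X → ℝ := fun e => if e.IsDiag then 0 else m e
  let M' : Sym2 X → ℝ := fun e => if e.IsDiag then 0 else M e
  have hmM' : ∀ e, m' e ≤ M' e := by
    intro e
    induction e with | _ i j
    by_cases hij : i = j
    · simp [m', M', hij]
    · simpa [m', M', hij] using hmM i j hij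
  have key : ∀ c : ι → ℤ, 0 ≤ boxSup r m' M' fun t => c t := by
    intro c
    have hv : (∑ t, c t • r t) ∈ AddSubgroup.closure (fourPointVectors S) :=
      sum_mem fun t _ => zsmul_mem (AddSubgroup.subset_closure
        (show r t ∈ fourPointVectors S from ⟨_, _, _, _, t.2, rfl⟩)) _
    obtain ⟨τ, σ, hd, hτσ, hc⟩ := exists_exchanges_of_mem_closure hS hv
    have hle := sum_map_sub_le_of_exchanges hS H hτσ hd
    have hσd := exchanges_not_isDiag hS hτσ hd
    have hm : ((σ - τ).map m).sum = ((σ - τ).map m').sum := by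
      congr 1
      refine Multiset.map_congr rfl fun e he => ?_
      simp [m', hσd e (Multiset.mem_of_le (Multiset.sub_le_self _ _) he)]
    have hM : ((τ - σ).map M).sum = ((τ - σ).map M').sum := by
      congr 1
      refine Multiset.map_congr rfl fun e he => ?_
      simp [M', hd e (Multiset.mem_of_le (Multiset.sub_le_self _ _) he)]
    have hsum : ∀ (s : Multiset (Sym2 X)) (g : Sym2 X → ℝ),
        (s.map g).sum = ∑ e, (s.count e : ℝ) * g e := by
      intro s g
      rw [Finset.sum_multiset_map_count]
      simp only [nsmul_eq_mul]
      refine Finset.sum_subset (Finset.subset_univ _) fun e _ he => ?_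
      simp [Multiset.count_eq_zero.2 (mt Multiset.mem_toFinset.2 he)]
    rw [hm, hM, hsum, hsum, ← sub_nonneg, ← Finset.sum_sub_distrib] at hle
    -- After cancellation each $e$ survives in at most one family: in $\tau-\sigma$ it is weighted
    -- by $M$, in $\sigma-\tau$ by $m$. Either way its term is one of the two entries of the
    -- maximum.
    refine hle.trans (Finset.sum_le_sum fun e _ => ?_)
    have hk : (∑ t, ((c t : ℤ) : ℝ) * (r t e : ℝ)) = (τ.count e : ℝ) - σ.count e := by
      have := hc e
      simp only [Finset.sum_apply, Pi.smul_apply, smul_eq_mul] at this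
      exact_mod_cast this
    rw [hk, Multiset.count_sub, Multiset.count_sub]
    rcases le_total (τ.count e) (σ.count e) with h | h
    · rw [Nat.sub_eq_zero_of_le h, Nat.cast_sub h]
      refine le_max_of_le_right (le_of_eq ?_)
      push_cast
      ring
    · rw [Nat.sub_eq_zero_of_le h, Nat.cast_sub h]
      refine le_max_of_le_left (le_of_eq ?_)
      push_cast
      ring
  obtain ⟨D, hD, hr⟩ := exists_box_solution r hmM' key
  refine ⟨D, fun i j hij => ?_, fun i j k l hs => ?_⟩
  · simpa [m', M', hij] using hD s(i, j)
  · have := hr ⟨(i, j, k, l), hs⟩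
    simp only [r, fourPointVector, Pi.add_apply, Pi.sub_apply, Pi.single_apply, Int.cast_add,
      Int.cast_sub, Int.cast_ite, Int.cast_one, Int.cast_zero, add_mul, sub_mul, ite_mul, one_mul,
      zero_mul, Finset.sum_add_distrib, Finset.sum_sub_distrib, Finset.sum_ite_eq',
      Finset.mem_univ, if_true] at this
    linarith

/-! ### Cherries of a fat, transitive and saturated system -/

section Cherry

variable {X : Type*}

/-- `a` and `b` are strictly separated from `z` and the root `r` by `S`. -/
def StrictTriple (S : Set (Sym2 (Sym2 X))) (r a b z : X) : Prop :=
  [a, b, z, r].Nodup ∧ split a b z r ∈ S ∧ split a z b r ∉ S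

/-- In a tree rooted at $r$: if $a,c$ meet strictly below where $a,b$ meet, and these strictly below
where $a,z$ meet, then $a,c$ meet strictly below where $a,z$ meet. -/
theorem StrictTriple.trans {S : Set (Sym2 (Sym2 X))} (ht : IsTransitiveSystem S)
    (hs : IsSaturated S) {r a b c z : X} (h : StrictTriple S r a c b)
    (h' : StrictTriple S r a b z) : StrictTriple S r a c z := by
  obtain ⟨hn, h1, h2⟩ := h
  obtain ⟨hn', h1', h2'⟩ := h'
  have hzc : z ≠ c := by
    rintro rfl
    exact h2 h1'
  have hnd : [a, b, c, z, r].Nodup := by simp at hn hn' ⊢; grind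
  have e1 : split a z b r = split a z r b := split_comm_right ..
  have e2 : split a z c r = split a z r c := split_comm_right ..
  have e3 : split a b c r = split a b r c := split_comm_right ..
  have hacbz : split a c b z ∈ S :=
    (hs a c b r z (by simp at hnd ⊢; grind) h1).resolve_left h2'
  have h3 := ht a c b z r (by simp at hnd ⊢; grind) hacbz h1
  refine ⟨by simp at hnd ⊢; grind, h3, fun h4 => ?_⟩
  rw [e2] at h4
  rcases hs a z r c b (by simp at hnd ⊢; grind) h4 with h | h
  · exact h2 (e3 ▸ h)
  · exact h2' (e1 ▸ h)

/-- Fix a root $r$ and choose the pair $a,b$ strictly separated from the largest number of $z$: a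
deepest pair. A $c$ with $(a,b\,|\,c,r)\notin S$ would, by fatness, make $(a,c)$ or $(b,c)$ strictly
deeper. Transitivity then eliminates $r$. -/
theorem exists_cherry [Finite X] {S : Set (Sym2 (Sym2 X))} (hf : IsFat S)
    (ht : IsTransitiveSystem S) (hs : IsSaturated S) (hX : 3 ≤ Nat.card X) :
    ∃ a b, a ≠ b ∧ ∀ c d, [a, b, c, d].Nodup → split a b c d ∈ S := by
  classical
  have := Fintype.ofFinite X
  rw [Nat.card_eq_fintype_card] at hX
  obtain ⟨r, a₀, b₀, h1, h2, h3⟩ := Fintype.two_lt_card_iff.1 hX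
  let f : X × X → ℕ := fun p => {z | StrictTriple S r p.1 p.2 z}.ncard
  obtain ⟨⟨a, b⟩, ⟨hab, har, hbr⟩, hmax⟩ := Set.exists_max_image
    {p : X × X | p.1 ≠ p.2 ∧ p.1 ≠ r ∧ p.2 ≠ r} f (Set.toFinite _)
    ⟨(a₀, b₀), h3, h1.symm, h2.symm⟩
  have hsymm : ∀ a b z, StrictTriple S r a b z → StrictTriple S r b a z := by
    rintro a b z ⟨hn, h, h'⟩
    refine ⟨by simp at hn ⊢; grind, by rwa [split_comm_left], fun h'' => h' ?_⟩
    have := hf a b z r hn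
    rw [show split b z a r = split a r b z from split_swap ..] at h''
    tauto
  have hlt : ∀ a b c, StrictTriple S r a c b → f (a, b) < f (a, c) := fun a b c h =>
    -- The inclusion is proper because $b$ itself is separated from $a,c$.
    Set.ncard_lt_ncard ⟨fun z hz => h.trans ht hs hz, fun hsub => by
      have : StrictTriple S r a b b := hsub (show b ∈ {z | StrictTriple S r a c z} from h)
      simpa using this.1⟩ (Set.toFinite _)
  have hroot : ∀ c, [a, b, c, r].Nodup → split a b c r ∈ S := by
    intro c hn
    by_contra hc
    rcases hf a b c r hn with h | h | ⟨-, h, -⟩ | ⟨-, -, h⟩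
    · exact hc h.1
    · exact hc h.1
    · have hst : StrictTriple S r a c b := ⟨by simp at hn ⊢; grind, h, hc⟩
      exact absurd (hmax (a, c) (by simp at hn ⊢; grind)) (not_le.2 (hlt a b c hst))
    · have hst : StrictTriple S r b c a :=
        ⟨by simp at hn ⊢; grind, by rwa [split_swap], by rwa [split_comm_left]⟩
      have hfs : f (b, a) = f (a, b) :=
        congrArg Set.ncard (Set.ext fun z => ⟨hsymm b a z, hsymm a b z⟩)
      have := hlt b a c hst
      rw [hfs] at this
      exact absurd (hmax (b, c) (by simp at hn ⊢; grind)) (not_le.2 this)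
  refine ⟨a, b, hab, fun c d hn => ?_⟩
  by_cases hcr : c = r
  · subst hcr
    rw [split_comm_right]
    exact hroot d (by simp at hn ⊢; grind)
  by_cases hdr : d = r
  · subst hdr
    exact hroot c hn
  refine ht a b r c d (by simp at hn ⊢; grind) ?_ ?_
  · rw [split_comm_right]
    exact hroot c (by simp at hn ⊢; grind)
  · rw [split_comm_right]
    exact hroot d (by simp at hn ⊢; grind)

end Cherry

/-! ### Weights of paths in trees -/

section TreeWeight

variable {V : Type*} {G : SimpleGraph V}

theorem twoWeight_eq_walkWeight (hG : G.IsAcyclic) (w : Sym2 V → ℝ) {u v : V} {p : G.Walk u v}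
    (hp : p.IsPath) : twoWeight G w u v = walkWeight w p := by
  have : (Set.range fun q : G.Path u v => walkWeight w q.1) = {walkWeight w p} := by
    ext x
    constructor
    · rintro ⟨q, rfl⟩
      have := hG.subsingleton_path u v
      rw [Subsingleton.elim q ⟨p, hp⟩]
      rfl
    · rintro rfl
      exact ⟨⟨p, hp⟩, rfl⟩
  rw [twoWeight, this, csInf_singleton]

theorem twoWeight_self (hG : G.IsAcyclic) (w : Sym2 V → ℝ) (u : V) : twoWeight G w u u = 0 := by
  rw [twoWeight_eq_walkWeight hG w SimpleGraph.Walk.IsPath.nil]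
  simp [walkWeight]

theorem twoWeight_comm (hG : G.IsTree) (w : Sym2 V → ℝ) (u v : V) :
    twoWeight G w u v = twoWeight G w v u := by
  obtain ⟨p, hp, -⟩ := hG.existsUnique_path u v
  rw [twoWeight_eq_walkWeight hG.isAcyclic w hp, twoWeight_eq_walkWeight hG.isAcyclic w hp.reverse]
  simp [walkWeight, SimpleGraph.Walk.edges_reverse]

end TreeWeight

/-! ### Attaching a leaf to a vertex of a tree -/

section AddLeaf

variable {V : Type*}

/-- The graph `G` with a new vertex `none`, joined to `v` only. -/
def addLeaf (G : SimpleGraph V) (v : V) : SimpleGraph (Option V) :=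
  G.map Function.Embedding.some ⊔ SimpleGraph.edge none (some v)

/-- The weight function `w`, with the weight `β` on all new edges. -/
noncomputable def addLeafWeight (w : Sym2 V → ℝ) (β : ℝ) : Sym2 (Option V) → ℝ :=
  Function.extend (Sym2.map some) w fun _ => β

variable {G : SimpleGraph V} {v : V}

theorem addLeaf_adj_some_some {x y : V} : (addLeaf G v).Adj (some x) (some y) ↔ G.Adj x y := by
  simpa [addLeaf, SimpleGraph.map_adj', SimpleGraph.edge_adj] using fun h => h.ne

theorem addLeaf_adj_none_some {x : V} : (addLeaf G v).Adj none (some x) ↔ x = v := by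
  simp [addLeaf, SimpleGraph.map_adj', SimpleGraph.edge_adj]

theorem addLeaf_adj_some_none {x : V} : (addLeaf G v).Adj (some x) none ↔ x = v := by
  rw [SimpleGraph.adj_comm, addLeaf_adj_none_some]

/-- The inclusion of `G` into `addLeaf G v`. -/
def addLeafHom (G : SimpleGraph V) (v : V) : G →g addLeaf G v where
  toFun := some
  map_rel' h := addLeaf_adj_some_some.2 h

theorem addLeaf_isTree [Finite V] (hG : G.IsTree) : (addLeaf G v).IsTree := by
  rw [SimpleGraph.isTree_iff_connected_and_card] at hG ⊢
  obtain ⟨hc, hcard⟩ := hG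
  have hr : ∀ x, (addLeaf G v).Reachable x (some v) := by
    rintro (_ | x)
    · exact (addLeaf_adj_none_some.2 rfl).reachable
    · exact (hc.preconnected x v).map (addLeafHom G v)
  refine ⟨⟨fun x y => (hr x).trans (hr y).symm⟩, ?_⟩
  have he : (addLeaf G v).edgeSet = insert s(none, some v) (Sym2.map some '' G.edgeSet) := by
    rw [addLeaf, SimpleGraph.edgeSet_sup, SimpleGraph.edgeSet_map,
      SimpleGraph.edgeSet_edge_of_ne (by simp), Set.union_comm]
    rfl
  have hn : s(none, some v) ∉ Sym2.map some '' G.edgeSet := by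
    rintro ⟨e, -, h⟩
    have : none ∈ Sym2.map some e := h ▸ Sym2.mem_mk_left _ _
    simp [Sym2.mem_map] at this
  rw [he, Nat.card_coe_set_eq, Set.ncard_insert_of_notMem hn,
    Set.ncard_image_of_injective _ (Sym2.map.injective (Option.some_injective V)),
    ← Nat.card_coe_set_eq, hcard, Finite.card_option]

theorem walkWeight_map_addLeafHom (w : Sym2 V → ℝ) (β : ℝ) {x y : V} (p : G.Walk x y) :
    walkWeight (addLeafWeight w β) (p.map (addLeafHom G v)) = walkWeight w p := by
  rw [walkWeight, SimpleGraph.Walk.edges_map, List.map_map, walkWeight]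
  congr 2
  funext e
  change addLeafWeight w β (Sym2.map some e) = w e
  exact (Sym2.map.injective (Option.some_injective V)).extend_apply w _ e

theorem twoWeight_addLeaf_some_some [Finite V] (hG : G.IsTree) (w : Sym2 V → ℝ) (β : ℝ) (x y : V) :
    twoWeight (addLeaf G v) (addLeafWeight w β) (some x) (some y) = twoWeight G w x y := by
  obtain ⟨p, hp, -⟩ := hG.existsUnique_path x y
  rw [twoWeight_eq_walkWeight hG.isAcyclic w hp, ← walkWeight_map_addLeafHom w β p]
  exact twoWeight_eq_walkWeight (addLeaf_isTree hG).isAcyclic _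
    (hp.map (f := addLeafHom G v) (Option.some_injective V))

theorem twoWeight_addLeaf_none_some [Finite V] (hG : G.IsTree) (w : Sym2 V → ℝ) (β : ℝ) (y : V) :
    twoWeight (addLeaf G v) (addLeafWeight w β) none (some y) = β + twoWeight G w v y := by
  obtain ⟨p, hp, -⟩ := hG.existsUnique_path v y
  rw [twoWeight_eq_walkWeight hG.isAcyclic w hp, ← walkWeight_map_addLeafHom (v := v) w β p]
  have hadj : (addLeaf G v).Adj none (addLeafHom G v v) := addLeaf_adj_none_some.2 rfl
  have hpath : (SimpleGraph.Walk.cons hadj (p.map (addLeafHom G v))).IsPath := by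
    rw [SimpleGraph.Walk.cons_isPath_iff]
    refine ⟨hp.map (f := addLeafHom G v) (Option.some_injective V), ?_⟩
    rw [SimpleGraph.Walk.support_map]
    simp [addLeafHom]
  refine (twoWeight_eq_walkWeight (addLeaf_isTree hG).isAcyclic _ hpath).trans ?_
  rw [walkWeight, SimpleGraph.Walk.edges_cons, List.map_cons, List.sum_cons]
  congr 1
  refine Function.extend_apply' _ _ _ ?_
  rintro ⟨e, h⟩
  have : none ∈ Sym2.map some e := h ▸ Sym2.mem_mk_left _ _
  simp [Sym2.mem_map] at this

theorem isLeaf_addLeaf_none : IsLeaf (addLeaf G v) none := by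
  have : (addLeaf G v).neighborSet none = {some v} := by
    ext (_ | x)
    · simp
    · simp [SimpleGraph.mem_neighborSet, addLeaf_adj_none_some]
  rw [IsLeaf, this, Set.ncard_singleton]

theorem isLeaf_addLeaf_some_iff {x : V} (hx : x ≠ v) :
    IsLeaf (addLeaf G v) (some x) ↔ IsLeaf G x := by
  have : (addLeaf G v).neighborSet (some x) = some '' G.neighborSet x := by
    ext (_ | y)
    · simp [SimpleGraph.mem_neighborSet, addLeaf_adj_some_none, hx]
    · simp [SimpleGraph.mem_neighborSet, addLeaf_adj_some_some]
  rw [IsLeaf, IsLeaf, this, Set.ncard_image_of_injective _ (Option.some_injective V)]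

theorem not_isLeaf_addLeaf_some {y : V} (hy : G.Adj v y) : ¬ IsLeaf (addLeaf G v) (some v) := by
  intro h
  obtain ⟨z, hz⟩ := Set.ncard_eq_one.1 h
  have h1 : none ∈ (addLeaf G v).neighborSet (some v) := addLeaf_adj_some_none.2 rfl
  have h2 : some y ∈ (addLeaf G v).neighborSet (some v) := addLeaf_adj_some_some.2 hy
  rw [hz] at h1 h2
  exact absurd (h1.trans h2.symm) (by simp)

end AddLeaf

/-! ### Realizing solutions of the four-point equations by trees -/

/-- `D` is the family of 2-weights of a weighted finite tree with leaves labelled by `X`. -/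
def IsTreeRealizable {X : Type*} (D : X → X → ℝ) : Prop :=
  ∃ (V : Type) (_ : Finite V) (G : SimpleGraph V) (w : Sym2 V → ℝ) (leaf : X → V),
    G.IsTree ∧ Function.Injective leaf ∧ Set.range leaf = {v | IsLeaf G v} ∧
    ∀ i j, i ≠ j → twoWeight G w (leaf i) (leaf j) = D i j

/-- A single edge. The induction starts here because a one-vertex tree has no leaf. -/
theorem isTreeRealizable_of_card_eq_two {X : Type} [Finite X] (hX : Nat.card X = 2)
    {D : X → X → ℝ} (hD : ∀ i j, D i j = D j i) : IsTreeRealizable D := by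
  classical
  obtain ⟨a, b, hab, hU⟩ := Nat.card_eq_two_iff.1 hX
  have hmem : ∀ x, x = a ∨ x = b := fun x => by
    have : x ∈ ({a, b} : Set X) := by rw [hU]; trivial
    simpa using this
  have htree : (⊤ : SimpleGraph X).IsTree := by
    refine ⟨@SimpleGraph.connected_top _ ⟨a⟩, SimpleGraph.IsAcyclic.of_card_le_two ?_⟩
    rw [ENat.card_eq_coe_natCard, hX]
    rfl
  refine ⟨X, inferInstance, ⊤, fun _ => D a b, id, htree, Function.injective_id, ?_, ?_⟩
  · rw [Set.range_id, eq_comm, Set.eq_univ_iff_forall]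
    intro x
    change ((⊤ : SimpleGraph X).neighborSet x).ncard = 1
    rw [Set.ncard_eq_one]
    rcases hmem x with rfl | rfl
    · exact ⟨b, by ext y; rcases hmem y with rfl | rfl <;> simp [hab, hab.symm]⟩
    · exact ⟨a, by ext y; rcases hmem y with rfl | rfl <;> simp [hab, hab.symm]⟩
  · intro i j hij
    have hadj : (⊤ : SimpleGraph X).Adj i j := hij
    rw [id, id, twoWeight_eq_walkWeight htree.isAcyclic _
      (SimpleGraph.Walk.IsPath.of_adj hadj)]
    have : D a b = D i j := by
      rcases hmem i with rfl | rfl <;> rcases hmem j with rfl | rfl <;>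
        first | exact absurd rfl hij | rfl | exact hD _ _
    simp [walkWeight, SimpleGraph.Adj.toWalk, this]

/-- In the smaller tree the leaf labelled $b$ stands for the attaching vertex of the cherry, hence
the correction by $\beta$. Hanging pendant edges of weights $\beta$ and $\alpha$ on it turns it into
an inner vertex, and their ends become $b$ and $a$. -/
theorem IsTreeRealizable.of_cherry {X : Type*} [DecidableEq X] {a b : X} (hab : a ≠ b) {D : X → X → ℝ}
    (hsymm : ∀ i j, D i j = D j i) {α β : ℝ} (hDab : D a b = α + β)
    (hD : ∀ c, c ≠ a → c ≠ b → D a c - α = D b c - β)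
    (h : IsTreeRealizable fun i j : {x // x ≠ a} =>
      D i j - (if (i : X) = b then β else 0) - (if (j : X) = b then β else 0)) :
    IsTreeRealizable D := by
  obtain ⟨V, hV, G, w, leaf, hG, hinj, hrange, hw⟩ := h
  let b' : {x // x ≠ a} := ⟨b, hab.symm⟩
  let v := leaf b'
  have hT₁ := addLeaf_isTree (v := v) hG
  have hT₂ := addLeaf_isTree (v := some v) hT₁
  have hleaf : ∀ x, IsLeaf G (leaf x) := fun x => by
    have : leaf x ∈ {v | IsLeaf G v} := hrange ▸ Set.mem_range_self x
    exact this
  let leaf₂ : X → Option (Option V) := fun x =>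
    if hx : x = a then none else if x = b then some none else some (some (leaf ⟨x, hx⟩))
  have la : leaf₂ a = none := by simp [leaf₂]
  have lb : leaf₂ b = some none := by simp [leaf₂, hab.symm]
  have lc : ∀ c (hc : c ≠ a), c ≠ b → leaf₂ c = some (some (leaf ⟨c, hc⟩)) := by
    intro c hc hcb
    simp [leaf₂, hc, hcb]
  have hne : ∀ c (hc : c ≠ a), c ≠ b → leaf ⟨c, hc⟩ ≠ v := by
    intro c hc hcb h
    exact hcb (congrArg Subtype.val (hinj h))
  refine ⟨_, inferInstance, addLeaf (addLeaf G v) (some v),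
    addLeafWeight (addLeafWeight w β) α, leaf₂, hT₂, ?_, ?_, ?_⟩
  · intro x y hxy
    simp only [leaf₂] at hxy
    split_ifs at hxy with h1 h2 h3 h4 h5 h6 <;> simp_all
    exact congrArg Subtype.val (hinj hxy)
  · ext u
    constructor
    · rintro ⟨x, rfl⟩
      by_cases hxa : x = a
      · subst hxa
        rw [la]
        exact isLeaf_addLeaf_none
      by_cases hxb : x = b
      · subst hxb
        rw [lb]
        exact (isLeaf_addLeaf_some_iff (by simp)).2 isLeaf_addLeaf_none
      · rw [lc x hxa hxb]
        have := hne x hxa hxb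
        exact (isLeaf_addLeaf_some_iff (by simpa using this)).2
          ((isLeaf_addLeaf_some_iff this).2 (hleaf _))
    · intro hu
      rcases u with _ | _ | u
      · exact ⟨a, la⟩
      · exact ⟨b, lb⟩
      · change IsLeaf _ _ at hu
        by_cases huv : u = v
        · subst huv
          exact absurd hu (not_isLeaf_addLeaf_some (y := none) (addLeaf_adj_some_none.2 rfl))
        · rw [isLeaf_addLeaf_some_iff (by simpa using huv), isLeaf_addLeaf_some_iff huv] at hu
          have hu' : u ∈ Set.range leaf := hrange ▸ hu
          obtain ⟨x, rfl⟩ := hu'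
          refine ⟨x, lc x x.2 fun hxb => huv ?_⟩
          exact congrArg leaf (Subtype.ext hxb)
  · have hbc : ∀ c (hc : c ≠ a), c ≠ b → twoWeight G w v (leaf ⟨c, hc⟩) = D b c - β := by
      intro c hc hcb
      rw [hw b' ⟨c, hc⟩ fun h => hcb (congrArg Subtype.val h).symm]
      simp [b', hcb]
    have Dab : twoWeight (addLeaf (addLeaf G v) (some v)) (addLeafWeight (addLeafWeight w β) α)
        (leaf₂ a) (leaf₂ b) = D a b := by
      rw [la, lb, twoWeight_addLeaf_none_some hT₁, twoWeight_comm hT₁,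
        twoWeight_addLeaf_none_some hG, twoWeight_self hG.isAcyclic, hDab, add_zero]
    have Dac : ∀ c, c ≠ a → c ≠ b → twoWeight (addLeaf (addLeaf G v) (some v))
        (addLeafWeight (addLeafWeight w β) α) (leaf₂ a) (leaf₂ c) = D a c := by
      intro c hc hcb
      rw [la, lc c hc hcb, twoWeight_addLeaf_none_some hT₁, twoWeight_addLeaf_some_some hG,
        hbc c hc hcb, ← hD c hc hcb]
      ring
    have Dbc : ∀ c, c ≠ a → c ≠ b → twoWeight (addLeaf (addLeaf G v) (some v))
        (addLeafWeight (addLeafWeight w β) α) (leaf₂ b) (leaf₂ c) = D b c := by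
      intro c hc hcb
      rw [lb, lc c hc hcb, twoWeight_addLeaf_some_some hT₁, twoWeight_addLeaf_none_some hG,
        hbc c hc hcb]
      ring
    intro i j hij
    by_cases hia : i = a
    · subst hia
      by_cases hjb : j = b
      · rw [hjb, Dab]
      · exact Dac j hij.symm hjb
    by_cases hja : j = a
    · subst hja
      rw [twoWeight_comm hT₂, hsymm]
      by_cases hib : i = b
      · rw [hib, Dab]
      · exact Dac i hia hib
    by_cases hib : i = b
    · subst hib
      exact Dbc j hja hij.symm
    by_cases hjb : j = b
    · subst hjb
      rw [twoWeight_comm hT₂, hsymm]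
      exact Dbc i hia hib
    rw [lc i hia hib, lc j hja hjb, twoWeight_addLeaf_some_some hT₁,
      twoWeight_addLeaf_some_some hG, hw _ _ fun h => hij (congrArg Subtype.val h)]
    simp [hib, hjb]

theorem isTreeRealizable_of_fourPoint (k : ℕ) : ∀ {X : Type} [Finite X], Nat.card X = k + 2 →
    ∀ {S : Set (Sym2 (Sym2 X))}, IsFat S → IsTransitiveSystem S → IsSaturated S →
    ∀ {D : X → X → ℝ}, (∀ i j, D i j = D j i) →
      (∀ i j k l, [j, k, i, l].Nodup → split j k i l ∈ S → D i k + D j l = D i j + D k l) →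
      IsTreeRealizable D := by
  induction k with
  | zero => exact fun hX _ _ _ _ _ hsymm _ => isTreeRealizable_of_card_eq_two hX hsymm
  | succ k ih =>
    intro X _ hX S hf ht hs D hsymm hD
    classical
    have := Fintype.ofFinite X
    obtain ⟨a, b, hab, hcherry⟩ := exists_cherry hf ht hs (by omega)
    obtain ⟨c, hc⟩ : ∃ c, c ∉ ({a, b} : Finset X) := by
      by_contra! h
      have h1 := Finset.card_le_card (fun x _ => h x : Finset.univ ⊆ ({a, b} : Finset X))
      rw [Finset.card_univ, ← Nat.card_eq_fintype_card, hX] at h1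
      have := Finset.card_le_two (a := a) (b := b)
      omega
    simp only [Finset.mem_insert, Finset.mem_singleton, not_or] at hc
    -- The solution of $\alpha+\beta=D_{ab}$ and $\alpha-\beta=D_{ac}-D_{bc}$; by the equation of
    -- $(a,b\,|\,c,d)$ the choice of $c$ does not matter.
    refine IsTreeRealizable.of_cherry hab hsymm (α := (D a b + (D a c - D b c)) / 2)
      (β := (D a b - (D a c - D b c)) / 2) (by ring) ?_ ?_
    · intro d hda hdb
      by_cases hdc : d = c
      · subst hdc
        ring
      · have hn : [a, b, c, d].Nodup := by
          simp
          grind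
        have := hD c a b d hn (hcherry c d hn)
        rw [hsymm c b, hsymm c a] at this
        linarith
    -- The value of $\beta$ is immaterial now: each index occurs once on either side of a four-point
    -- equation, so the correction at $b$ cancels.
    · generalize (D a b - (D a c - D b c)) / 2 = β
      let φ : Sym2 (Sym2 {x // x ≠ a}) → Sym2 (Sym2 X) := Sym2.map (Sym2.map Subtype.val)
      have hφ : ∀ i j k l, split i j k l ∈ φ ⁻¹' S ↔ split (i : X) j k l ∈ S := fun _ _ _ _ => Iff.rfl
      have hnd : ∀ l : List {x // x ≠ a}, (l.map Subtype.val).Nodup ↔ l.Nodup := fun l =>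
        List.nodup_map_iff Subtype.val_injective
      refine ih (S := φ ⁻¹' S) ?_ ?_ ?_ ?_ ?_ ?_
      · rw [Nat.card_eq_fintype_card, Fintype.card_subtype_compl, Fintype.card_subtype_eq,
          ← Nat.card_eq_fintype_card, hX]
        omega
      · exact fun i j k l hn => hf i j k l ((hnd [i, j, k, l]).2 hn)
      · exact fun i j k l x hn => ht i j k l x ((hnd [i, j, k, l, x]).2 hn)
      · exact fun i j k l x hn => hs i j k l x ((hnd [i, j, k, l, x]).2 hn)
      · intro i j
        rw [hsymm]
        grind
      · intro i j k l hn h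
        have := hD i j k l ((hnd [j, k, i, l]).2 hn) h
        linarith

/-! ### Split systems of compatible families of cuts -/

section Cuts

variable {X E : Type*}

/-- Any two of the bipartitions `χ e` of `X` are compatible: one of the four intersections of their
sides is empty. -/
def IsCompatible (χ : E → X → Bool) : Prop :=
  ∀ e f p q r s, χ e p = χ e q → χ e r = χ e s → χ f p = χ f r → χ f q = χ f s →
    χ e p = χ e r ∨ χ f p = χ f q

/-- A cut that separates both $a,b$ and $c,d$ induces one of the other two splits of the quartet. -/
theorem Bool.eq_and_eq_or_of_ne : ∀ {x y z t : Bool}, x ≠ y → z ≠ t →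
    (x = z ∧ y = t) ∨ (x = t ∧ y = z) := by
  decide

/-- The splits `(a, b | c, d)` such that no `χ e` induces a different split on `a, b, c, d`. -/
def cutSplits (χ : E → X → Bool) : Set (Sym2 (Sym2 X)) :=
  {s | ∃ a b c d, [a, b, c, d].Nodup ∧ s = split a b c d ∧ ∀ e, χ e a = χ e b ∨ χ e c = χ e d}

theorem isSplitSystem_cutSplits (χ : E → X → Bool) : IsSplitSystem (cutSplits χ) := by
  rintro s ⟨a, b, c, d, hn, hs, -⟩
  exact ⟨a, b, c, d, hn, hs⟩

theorem split_mem_cutSplits {χ : E → X → Bool} {a b c d : X} (hn : [a, b, c, d].Nodup) :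
    split a b c d ∈ cutSplits χ ↔ ∀ e, χ e a = χ e b ∨ χ e c = χ e d := by
  constructor
  · rintro ⟨a', b', c', d', -, he, h⟩ e
    have := h e
    rw [split_eq_split_iff] at he
    grind
  · exact fun h => ⟨a, b, c, d, hn, rfl, h⟩

/-- If some cut divides the quartet two against two, it contradicts the other two splits, and by
compatibility no cut contradicts its own. If no cut does, nothing is contradicted and all three
splits are present. -/
theorem isFat_cutSplits {χ : E → X → Bool} (hχ : IsCompatible χ) : IsFat (cutSplits χ) := by
  intro a b c d hn
  rw [split_mem_cutSplits hn, split_mem_cutSplits (by simp at hn ⊢; grind),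
    split_mem_cutSplits (by simp at hn ⊢; grind)]
  by_cases h₁ : ∃ e, χ e a = χ e b ∧ χ e c = χ e d ∧ χ e a ≠ χ e c
  · obtain ⟨e, h⟩ := h₁
    refine Or.inr (Or.inl ⟨fun f => ?_, fun hf => ?_, fun hf => ?_⟩)
    · have h1 := hχ e f a b c d
      have h0 := @Bool.eq_and_eq_or_of_ne (χ f a) (χ f b) (χ f c) (χ f d)
      have h2 := hχ e f a b d c
      grind
    · grind [hf e]
    · grind [hf e]
  by_cases h₂ : ∃ e, χ e a = χ e c ∧ χ e b = χ e d ∧ χ e a ≠ χ e b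
  · obtain ⟨e, h⟩ := h₂
    refine Or.inr (Or.inr (Or.inl ⟨fun hf => ?_, fun f => ?_, fun hf => ?_⟩))
    · grind [hf e]
    · have h1 := hχ e f a c b d
      have h0 := @Bool.eq_and_eq_or_of_ne (χ f a) (χ f c) (χ f b) (χ f d)
      have h2 := hχ e f a c d b
      grind
    · grind [hf e]
  by_cases h₃ : ∃ e, χ e a = χ e d ∧ χ e b = χ e c ∧ χ e a ≠ χ e b
  · obtain ⟨e, h⟩ := h₃
    refine Or.inr (Or.inr (Or.inr ⟨fun hf => ?_, fun hf => ?_, fun f => ?_⟩))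
    · grind [hf e]
    · grind [hf e]
    · have h1 := hχ e f a d b c
      have h0 := @Bool.eq_and_eq_or_of_ne (χ f a) (χ f d) (χ f b) (χ f c)
      have h2 := hχ e f a d c b
      grind
  · push Not at h₁ h₂ h₃
    clear hn
    refine Or.inl ⟨fun e => ?_, fun e => ?_, fun e => ?_⟩ <;>
      · have := @Bool.eq_and_eq_or_of_ne (χ e a) (χ e b) (χ e c) (χ e d)
        have := @Bool.eq_and_eq_or_of_ne (χ e a) (χ e c) (χ e b) (χ e d)
        have := @Bool.eq_and_eq_or_of_ne (χ e a) (χ e d) (χ e b) (χ e c)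
        have := h₁ e
        have := h₂ e
        have := h₃ e
        grind

theorem isTransitiveSystem_cutSplits (χ : E → X → Bool) : IsTransitiveSystem (cutSplits χ) := by
  intro a b c d e hn h h'
  rw [split_mem_cutSplits (by simp at hn ⊢; grind)] at h h' ⊢
  intro f
  grind [h f, h' f]

/-- Suppose $e$ contradicts the first alternative and $f$ the second. By hypothesis $e$ keeps
$a_1,a_2$ together and $f$ keeps $b_1,b_2$ together. Then $a_1$, $a_2$, $x$ and the $b_j$ on the
same side of $e$ as $x$ occupy all four intersections of sides. -/
theorem isSaturated_cutSplits {χ : E → X → Bool} (hχ : IsCompatible χ) :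
    IsSaturated (cutSplits χ) := by
  intro a₁ a₂ b₁ b₂ x hn h
  rw [split_mem_cutSplits (by simp at hn ⊢; grind)] at h
  rw [split_mem_cutSplits (by simp at hn ⊢; grind), split_mem_cutSplits (by simp at hn ⊢; grind)]
  by_contra! hc
  obtain ⟨⟨e, he⟩, ⟨f, hf⟩⟩ := hc
  have h1 := h e
  have h2 := h f
  have h7 := @Bool.eq_and_eq_or_of_ne (χ e a₁) (χ e x) (χ e b₁) (χ e b₂)
  have h8 := @Bool.eq_and_eq_or_of_ne (χ f a₁) (χ f a₂) (χ f b₁) (χ f x)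
  have h3 := hχ e f a₁ a₂ b₁ x
  have h4 := hχ e f a₁ a₂ x b₁
  have h5 := hχ e f a₁ a₂ b₂ x
  have h6 := hχ e f a₁ a₂ x b₂
  grind

end Cuts

/-! ### The cuts of a tree -/

section TreeCuts

variable {V : Type*} {G : SimpleGraph V}

/-- The edge is a bridge, and every vertex still reaches one of its ends, so exactly two components
remain. -/
theorem exists_cut_of_isTree (hG : G.IsTree) {e : Sym2 V} (he : e ∈ G.edgeSet) :
    ∃ χ : V → Bool, ∀ u v, χ u = χ v ↔ (G.deleteEdges {e}).Reachable u v := by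
  classical
  induction e with | _ x y
  have hxy : ¬ (G.deleteEdges {s(x, y)}).Reachable x y :=
    SimpleGraph.isBridge_iff.1 (SimpleGraph.isAcyclic_iff_forall_isBridge.1 hG.isAcyclic he)
  have hcover : ∀ v, (G.deleteEdges {s(x, y)}).Reachable v x ∨
      (G.deleteEdges {s(x, y)}).Reachable v y := by
    intro v
    obtain ⟨p⟩ := hG.connected.preconnected v x
    induction p with
    | nil => exact Or.inl .rfl
    | @cons u v w h p ih =>
      by_cases huv : s(u, v) = s(w, y)
      · rcases Sym2.eq_iff.1 huv with ⟨rfl, -⟩ | ⟨rfl, -⟩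
        · exact Or.inl .rfl
        · exact Or.inr .rfl
      · have hadj : (G.deleteEdges {s(w, y)}).Adj u v := by
          rw [SimpleGraph.deleteEdges_adj]
          exact ⟨h, huv⟩
        exact (ih he hxy).imp hadj.reachable.trans hadj.reachable.trans
  refine ⟨fun v => decide ((G.deleteEdges {s(x, y)}).Reachable v x), fun u v => ?_⟩
  rw [decide_eq_decide]
  constructor
  · intro h
    by_cases hu : (G.deleteEdges {s(x, y)}).Reachable u x
    · exact hu.trans (h.1 hu).symm
    · exact ((hcover u).resolve_left hu).trans ((hcover v).resolve_left (mt h.2 hu)).symm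
  · exact fun h => ⟨h.symm.trans, h.trans⟩

theorem exists_cuts_of_isTree (hG : G.IsTree) :
    ∃ χ : G.edgeSet → V → Bool, ∀ e u v, χ e u = χ e v ↔ (G.deleteEdges {e.1}).Reachable u v := by
  choose χ hχ using fun e : G.edgeSet => exists_cut_of_isTree hG e.2
  exact ⟨χ, hχ⟩

/-- If `p` and `q` are joined off `e`, on the side of `e` not containing the edge `f`, then they
are joined off `f`. -/
theorem reachable_deleteEdges_of_not_reachable {e : Sym2 V} {x y p q : V}
    (hpq : (G.deleteEdges {e}).Reachable p q) (hx : ¬ (G.deleteEdges {e}).Reachable p x) :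
    (G.deleteEdges {s(x, y)}).Reachable p q := by
  obtain ⟨w⟩ := hpq
  induction w with
  | nil => exact .rfl
  | @cons u v w h p ih =>
    have hv : ¬ (G.deleteEdges {e}).Reachable v x := fun h' => hx (h.reachable.trans h')
    refine SimpleGraph.Reachable.trans (SimpleGraph.Adj.reachable ?_) (ih hv)
    rw [SimpleGraph.deleteEdges_adj] at h ⊢
    refine ⟨h.1, fun h' => ?_⟩
    rcases Sym2.eq_iff.1 (Set.mem_singleton_iff.1 h') with ⟨rfl, -⟩ | ⟨-, rfl⟩
    · exact hx .rfl
    · exact hv .rfl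

/-- An end $x$ of $f$ lies on one side of $e$; paths within the other side miss $x$, so $f$ does not
separate two points there. -/
theorem isCompatible_of_reachable {χ : G.edgeSet → V → Bool}
    (hχ : ∀ e u v, χ e u = χ e v ↔ (G.deleteEdges {e.1}).Reachable u v) : IsCompatible χ := by
  rintro e ⟨f, hf⟩ p q r s hpq hrs hpr hqs
  by_contra! h
  induction f with | _ x y
  by_cases hx : χ e p = χ e x
  · have hrx : ¬ χ e r = χ e x := fun h' => h.1 (hx.trans h'.symm)
    refine h.2 ?_
    rw [hpr, hqs, hχ]
    exact reachable_deleteEdges_of_not_reachable ((hχ _ _ _).1 hrs) (mt (hχ _ _ _).2 hrx)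
  · refine h.2 ((hχ _ _ _).2 ?_)
    exact reachable_deleteEdges_of_not_reachable ((hχ _ _ _).1 hpq) (mt (hχ _ _ _).2 hx)

/-- An edge separates $u$ from $v$ exactly when it lies on their unique path. -/
theorem twoWeight_eq_sum_cuts [Fintype G.edgeSet] (hG : G.IsTree) (w : Sym2 V → ℝ)
    {χ : G.edgeSet → V → Bool}
    (hχ : ∀ e u v, χ e u = χ e v ↔ (G.deleteEdges {e.1}).Reachable u v) (u v : V) :
    twoWeight G w u v = ∑ e, if χ e u = χ e v then 0 else w e := by
  classical
  obtain ⟨p, hp, -⟩ := hG.existsUnique_path u v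
  rw [twoWeight_eq_walkWeight hG.isAcyclic w hp, walkWeight,
    ← List.sum_toFinset w hp.isTrail.edges_nodup]
  have hsep : ∀ e : G.edgeSet, χ e u = χ e v ↔ e.1 ∉ p.edges := by
    rintro ⟨e, he⟩
    rw [hχ]
    induction e with | _ x y
    rw [SimpleGraph.reachable_deleteEdges_iff_exists_walk]
    refine ⟨?_, fun h => ⟨p, h⟩⟩
    rintro ⟨q, hq⟩ h
    have := hG.isAcyclic.subsingleton_path u v
    have : p = q.bypass := congrArg Subtype.val
      (Subsingleton.elim (⟨p, hp⟩ : G.Path u v) ⟨q.bypass, q.bypass_isPath⟩)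
    exact hq (q.edges_bypass_subset_edges (this ▸ h))
  simp only [hsep, ite_not]
  rw [← Finset.sum_subtype G.edgeFinset (fun e => SimpleGraph.mem_edgeFinset)
    (fun e => if e ∈ p.edges then w e else 0), ← Finset.sum_filter]
  refine Finset.sum_congr ?_ fun _ _ => rfl
  ext e
  simpa using fun h => p.edges_subset_edgeSet h

end TreeCuts

theorem sum_map_eq_of_exchanges {X : Type*} {S : Set (Sym2 (Sym2 X))} {D : Sym2 X → ℝ}
    (hD : ∀ i j k l, split j k i l ∈ S → D s(i, k) + D s(j, l) = D s(i, j) + D s(k, l))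
    {τ σ : Multiset (Sym2 X)} (h : Relation.ReflTransGen (Exchange S) τ σ) :
    (σ.map D).sum = (τ.map D).sum := by
  induction h with
  | refl => rfl
  | tail _ h ih =>
    obtain ⟨i, j, k, l, ρ, hs, rfl, rfl⟩ := h
    have := hD i j k l hs
    simp only [Multiset.map_cons, Multiset.sum_cons] at ih ⊢
    linarith

theorem exists_split_system_of_weightedTree {n : ℕ} {m M : Sym2 (Fin n) → ℝ} (T : WeightedTree n)
    (hT : ∀ i j : Fin n, i ≠ j → T.D i j ∈ Set.Icc (m s(i, j)) (M s(i, j))) :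
    ∃ S : Set (Sym2 (Sym2 (Fin n))),
      IsSplitSystem S ∧ (IsFat S ∧ IsTransitiveSystem S ∧ IsSaturated S) ∧
      ∀ (A : Multiset (Fin n)) (σ τ : Multiset (Sym2 (Fin n))),
        IsPairPartition A σ → IsPairPartition A τ → Relation.ReflTransGen (Exchange S) τ σ →
        (σ.map m).sum ≤ (τ.map M).sum := by
  classical
  obtain ⟨χ, hχ⟩ := exists_cuts_of_isTree T.isTree
  have := T.finite
  have := Fintype.ofFinite T.graph.edgeSet
  have hc : IsCompatible fun e i => χ e (T.leaf i) := fun e f p q r s =>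
    isCompatible_of_reachable hχ e f _ _ _ _
  have hS := isSplitSystem_cutSplits fun e i => χ e (T.leaf i)
  refine ⟨_, hS, ⟨isFat_cutSplits hc, isTransitiveSystem_cutSplits _, isSaturated_cutSplits hc⟩, ?_⟩
  intro A σ τ hσ hτ h
  let D : Sym2 (Fin n) → ℝ := Sym2.lift ⟨T.D, fun i j => twoWeight_comm T.isTree _ _ _⟩
  have hDmem : ∀ e : Sym2 (Fin n), ¬ e.IsDiag → m e ≤ D e ∧ D e ≤ M e := by
    intro e he
    induction e with | _ i j
    exact hT i j he
  have hD : ∀ i j k l, split j k i l ∈ cutSplits (fun e i => χ e (T.leaf i)) →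
      D s(i, k) + D s(j, l) = D s(i, j) + D s(k, l) := by
    intro i j k l hs
    rw [split_mem_cutSplits (hS.nodup hs)] at hs
    simp only [D, Sym2.lift_mk, WeightedTree.D, twoWeight_eq_sum_cuts T.isTree _ hχ,
      ← Finset.sum_add_distrib]
    -- The equation holds edge by edge: if a cut does not separate $j,k$, or does not separate
    -- $i,l$, then the exchange leaves its contribution unchanged.
    refine Finset.sum_congr rfl fun e _ => ?_
    rcases hs e with h | h
    · rw [h, add_comm]
    · simp only [h, eq_comm, add_comm]
  calc (σ.map m).sum ≤ (σ.map D).sum :=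
        Multiset.sum_map_le_sum_map _ _ fun e he => (hDmem e (hσ.1 e he)).1
    _ = (τ.map D).sum := sum_map_eq_of_exchanges hD h
    _ ≤ (τ.map M).sum := Multiset.sum_map_le_sum_map _ _ fun e he => (hDmem e (hτ.1 e he)).2

/-- The families `m`, `M` are indexed by unordered pairs; only their values at pairs of distinct
elements (the 2-subsets of `Fin n`) matter. -/
theorem mainTheorem3 (n : ℕ) (hn : 2 ≤ n) (m M : Sym2 (Fin n) → ℝ)
    (hmM : ∀ i j : Fin n, i ≠ j → m s(i, j) ≤ M s(i, j)) :
    (∃ T : WeightedTree n, ∀ i j : Fin n, i ≠ j → T.D i j ∈ Set.Icc (m s(i, j)) (M s(i, j))) ↔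
    ∃ S : Set (Sym2 (Sym2 (Fin n))),
      IsSplitSystem S ∧ (IsFat S ∧ IsTransitiveSystem S ∧ IsSaturated S) ∧
      ∀ (A : Multiset (Fin n)) (σ τ : Multiset (Sym2 (Fin n))),
        IsPairPartition A σ → IsPairPartition A τ → Relation.ReflTransGen (Exchange S) τ σ →
        (σ.map m).sum ≤ (τ.map M).sum := by
  constructor
  · rintro ⟨T, hT⟩
    exact exists_split_system_of_weightedTree T hT
  · rintro ⟨S, hS, ⟨hf, ht, hs⟩, H⟩
    obtain ⟨D, hD, hD4⟩ := exists_fourPoint_solution hS hmM H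
    obtain ⟨V, hV, G, w, leaf, hG, hinj, hrange, hw⟩ :=
      isTreeRealizable_of_fourPoint (n - 2) (X := Fin n) (by rw [Nat.card_fin]; omega) hf ht hs
        (D := fun i j => D s(i, j)) (fun i j => by rw [Sym2.eq_swap])
        (fun i j k l _ h => hD4 i j k l h)
    refine ⟨⟨V, hV, G, hG, w, leaf, hinj, hrange⟩, fun i j hij => ?_⟩
    rw [WeightedTree.D, hw i j hij]
    exact hD i j hij
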